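/- An almost disjoint family is a family $\mathcal F$ of infinite subsets of $\mathbb N$ such that any two distinct members of $\mathcal F$ have finite intersection; a maximal almost disjoint (MAD) family is an almost disjoint family that is maximal with respect to inclusion. For an almost disjoint family $\mathcal F$, the Johnson-Lindenstrauss space $JL_2(\mathcal F)$ is the real Banach space obtained as the completion of $\operatorname{span}(c_0\cup\{\chi_N : N\in\mathcal F\})\subseteq \ell_\infty$ with respect to the norm $$\Bigl\|x+\sum_{r=1}^k a_r\chi_{N_r}\Bigr\| := \max\Bigl\{\Bigl\|x+\sum_{r=1}^k a_r\chi_{N_r}\Bigr\|_\infty,\ \Bigl(\sum_{r=1}^k a_r^2\Bigr)^{1/2}\Bigr\},$$ where $x\in c_0$, $N_1,\dots,N_k\in\mathcal F$ are distinct and $a_1,\dots,a_k\in\mathbb R$. Theorem. Assume the Continuum Hypothesis. Then there exists an infinite MAD family $\mathcal F_+$ such that every norm-bounded sequence $(x_n^*)_{n\in\mathbb N}$ in $JL_2(\mathcal F_+)^*$ for which $0$ is a weak$^*$-cluster point has a subsequence $(x_{n_k}^*)_{k\in\mathbb N}$ such that $$w^*\text{-}\lim_{k\to\infty}\frac1k\bigl(x_{n_1}^*+x_{n_2}^*+\dots+x_{n_k}^*\bigr)=0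 .$$ -/

import Mathlib

open Filter Topology
open scoped ENNReal

/-- An almost disjoint family: a family of infinite subsets of `ℕ` any two distinct members of
which have finite intersection. -/
def IsAlmostDisjoint (F : Set (Set ℕ)) : Prop :=
  (∀ N ∈ F, N.Infinite) ∧ ∀ M ∈ F, ∀ N ∈ F, M ≠ N → (M ∩ N).Finite

/-- A maximal almost disjoint family: an almost disjoint family that is maximal, with respect to
inclusion, among all almost disjoint families. -/
def IsMADFamily (F : Set (Set ℕ)) : Prop :=
  Maximal IsAlmostDisjoint F

/-- The Banach space `ℓ_∞` of bounded real sequences with the supremum norm. -/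
abbrev EllInfty : Type := lp (fun _ : ℕ => ℝ) ∞

/-- The space `c₀` of null sequences, as a subspace of `ℓ_∞`. -/
def cZero : Submodule ℝ EllInfty where
  carrier := {x | Tendsto (fun n => x n) atTop (𝓝 0)}
  add_mem' := by
    intro x y hx hy
    have h := Tendsto.add (show Tendsto (fun n => x n) atTop (𝓝 0) from hx)
      (show Tendsto (fun n => y n) atTop (𝓝 0) from hy)
    simpa using h
  zero_mem' := by
    simp
  smul_mem' := by
    intro c x hx
    have h := Tendsto.const_mul c (show Tendsto (fun n => x n) atTop (𝓝 0) from hx)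
    simpa using h

/-- The characteristic function `χ_N` of a set `N ⊆ ℕ`, as an element of `ℓ_∞`. -/
noncomputable def chi (N : Set ℕ) : EllInfty :=
  ⟨N.indicator (fun _ => (1 : ℝ)), by
    refine memℓp_infty ⟨1, ?_⟩
    rintro _ ⟨n, rfl⟩
    by_cases h : n ∈ N <;> simp [h]⟩

theorem chi_apply (N : Set ℕ) (n : ℕ) : chi N n = N.indicator (fun _ => (1 : ℝ)) n := rfl

/-- The subspace `span (c₀ ∪ {χ_N : N ∈ F})` of `ℓ_∞`. -/
noncomputable def jlSubmodule (F : Set (Set ℕ)) : Submodule ℝ EllInfty :=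
  Submodule.span ℝ ((cZero : Set EllInfty) ∪ chi '' F)

/-- The linear map `(x, a) ↦ x + ∑_{N ∈ F} a_N χ_N`, for `x ∈ c₀` and finitely supported `a`. -/
noncomputable def jlSum (F : Set (Set ℕ)) : cZero × (F →₀ ℝ) →ₗ[ℝ] EllInfty :=
  cZero.subtype.coprod (Finsupp.linearCombination ℝ (fun N : F => chi N))

theorem jlSum_apply (F : Set (Set ℕ)) (x : cZero) (a : F →₀ ℝ) :
    jlSum F (x, a) = (x : EllInfty) + ∑ N ∈ a.support, a N • chi N := by
  simp [jlSum, Finsupp.linearCombination_apply, Finsupp.sum]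

theorem range_jlSum (F : Set (Set ℕ)) : LinearMap.range (jlSum F) = jlSubmodule F := by
  rw [jlSum, LinearMap.range_coprod, Finsupp.range_linearCombination, Submodule.range_subtype,
    jlSubmodule, Submodule.span_union, Submodule.span_eq]
  congr 2
  ext y
  simp

/-- For an almost disjoint family, along each `N ∈ F` the element `x + ∑_M a_M χ_M` converges
to `a_N`. -/
theorem jlSum_tendsto {F : Set (Set ℕ)} (hF : IsAlmostDisjoint F) (x : cZero) (a : F →₀ ℝ)
    (N : F) : Tendsto (fun n => jlSum F (x, a) n) (atTop ⊓ 𝓟 (N : Set ℕ)) (𝓝 (a N)) := by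
  have hx : Tendsto (fun n => (x : EllInfty) n) (atTop ⊓ 𝓟 (N : Set ℕ)) (𝓝 0) :=
    (show Tendsto (fun n => (x : EllInfty) n) atTop (𝓝 0) from x.2).mono_left inf_le_left
  have hM : ∀ M ∈ a.support, Tendsto (fun n => a M * chi M n) (atTop ⊓ 𝓟 (N : Set ℕ))
      (𝓝 (if M = N then a M else 0)) := by
    intro M _
    refine Tendsto.congr' ?_ tendsto_const_nhds
    by_cases h : M = N
    · subst h
      filter_upwards [mem_inf_of_right (mem_principal_self (M : Set ℕ))] with n hn
      simp [chi_apply, hn]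
    · have hfin := hF.2 M M.2 N N.2 (fun h' => h (Subtype.ext h'))
      have hev : ∀ᶠ n in atTop, n ∉ (M : Set ℕ) ∩ N := by
        rw [← Nat.cofinite_eq_atTop]
        exact hfin.compl_mem_cofinite
      filter_upwards [mem_inf_of_right (mem_principal_self (N : Set ℕ)),
        hev.filter_mono inf_le_left] with n hn hn'
      have hnM : n ∉ (M : Set ℕ) := fun h' => hn' ⟨h', hn⟩
      simp [chi_apply, hnM, h]
  have h := hx.add (tendsto_finsetSum a.support hM)
  have e : (0 : ℝ) + ∑ M ∈ a.support, (if M = N then a M else 0) = a N := by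
    simp only [zero_add, Finset.sum_ite_eq']
    split_ifs with h0
    · rfl
    · exact (Finsupp.notMem_support_iff.1 h0).symm
  rw [e] at h
  refine h.congr fun n => ?_
  rw [jlSum_apply]
  simp only [lp.coeFn_add, lp.coeFn_sum, lp.coeFn_smul, Pi.add_apply]
  congr 1
  exact (Finset.sum_apply n a.support (fun i : F => a i • (chi i : ℕ → ℝ))).symm

/-- The representation of an element of `span (c₀ ∪ {χ_N : N ∈ F})` as
`x + ∑_{N ∈ F} a_N χ_N` is unique. -/
theorem jlSum_injective {F : Set (Set ℕ)} (hF : IsAlmostDisjoint F) :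
    Function.Injective (jlSum F) := by
  rw [injective_iff_map_eq_zero]
  rintro ⟨x, a⟩ h
  have ha : a = 0 := by
    ext N
    have h1 := jlSum_tendsto hF x a N
    rw [h] at h1
    have hne : (atTop ⊓ 𝓟 (N : Set ℕ)).NeBot := by
      rw [← Nat.cofinite_eq_atTop]
      exact (hF.1 N N.2).cofinite_inf_principal_neBot
    exact tendsto_nhds_unique h1 (by simp)
  subst ha
  rw [jlSum_apply] at h
  have hx : x = 0 := by
    ext1
    simpa using h
  simp [hx]

/-- The space `span (c₀ ∪ {χ_N : N ∈ F})`, as a type that does not inherit the supremum norm. -/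
def JLSpan (F : Set (Set ℕ)) (_hF : IsAlmostDisjoint F) : Type := jlSubmodule F

section JLSpan

variable (F : Set (Set ℕ)) (hF : IsAlmostDisjoint F)

noncomputable instance : AddCommGroup (JLSpan F hF) :=
  inferInstanceAs (AddCommGroup (jlSubmodule F))

noncomputable instance : Module ℝ (JLSpan F hF) :=
  inferInstanceAs (Module ℝ (jlSubmodule F))

/-- The inclusion of `span (c₀ ∪ {χ_N : N ∈ F})` in `ℓ_∞`. -/
noncomputable def JLSpan.incl : JLSpan F hF →ₗ[ℝ] EllInfty := (jlSubmodule F).subtype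

/-- The bijection `(x, a) ↦ x + ∑_{N ∈ F} a_N χ_N` onto `span (c₀ ∪ {χ_N : N ∈ F})`. -/
noncomputable def JLSpan.equiv : (cZero × (F →₀ ℝ)) ≃ₗ[ℝ] JLSpan F hF :=
  (LinearEquiv.ofInjective (jlSum F) (jlSum_injective hF)).trans
    (LinearEquiv.ofEq _ _ (range_jlSum F))

theorem JLSpan.incl_equiv (p : cZero × (F →₀ ℝ)) :
    JLSpan.incl F hF (JLSpan.equiv F hF p) = jlSum F p := rfl

/-- The coefficients `a` in the unique representation `y = x + ∑_{N ∈ F} a_N χ_N`. -/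
noncomputable def JLSpan.coeff : JLSpan F hF →ₗ[ℝ] (F →₀ ℝ) :=
  (LinearMap.snd ℝ cZero (F →₀ ℝ)).comp (JLSpan.equiv F hF).symm.toLinearMap

theorem JLSpan.coeff_equiv (x : cZero) (a : F →₀ ℝ) :
    JLSpan.coeff F hF (JLSpan.equiv F hF (x, a)) = a := by
  simp [JLSpan.coeff]

theorem sqrt_sum_sq_add_le {ι : Type} (a b : ι →₀ ℝ) :
    √((a + b).sum fun _ t => t ^ 2) ≤
      √(a.sum fun _ t => t ^ 2) + √(b.sum fun _ t => t ^ 2) := by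
  classical
  have key : ∀ c : ι →₀ ℝ, c.support ⊆ a.support ∪ b.support →
      √(c.sum fun _ t => t ^ 2) =
        (∑ i ∈ a.support ∪ b.support, |c i| ^ (2 : ℝ)) ^ (1 / (2 : ℝ)) := by
    intro c hc
    rw [Finsupp.sum_of_support_subset c hc _ (by simp), Real.sqrt_eq_rpow]
    simp
  rw [key _ Finsupp.support_add, key a Finset.subset_union_left,
    key b Finset.subset_union_right]
  exact Real.Lp_add_le _ _ _ (by norm_num)

/-- The norm `max {‖x + ∑ a_N χ_N‖_∞, (∑ a_N²)^{1/2}}` of `y = x + ∑ a_N χ_N`. -/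
noncomputable def jlNorm : AddGroupNorm (JLSpan F hF) where
  toFun y := max ‖JLSpan.incl F hF y‖ (√((JLSpan.coeff F hF y).sum fun _ t => t ^ 2))
  map_zero' := by simp
  add_le' y z := by
    rw [map_add, map_add]
    refine max_le ((norm_add_le _ _).trans ?_) ((sqrt_sum_sq_add_le _ _).trans ?_)
    · exact add_le_add (le_max_left _ _) (le_max_left _ _)
    · exact add_le_add (le_max_right _ _) (le_max_right _ _)
  neg' y := by
    rw [map_neg, map_neg, norm_neg]
    simp [Finsupp.sum]
  eq_zero_of_map_eq_zero' y h := by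
    have h1 : ‖JLSpan.incl F hF y‖ ≤ 0 := h ▸ le_max_left _ _
    exact Subtype.ext (norm_le_zero_iff.1 h1)

noncomputable instance : NormedAddCommGroup (JLSpan F hF) :=
  (jlNorm F hF).toNormedAddCommGroup

theorem JLSpan.norm_def (y : JLSpan F hF) :
    ‖y‖ = max ‖JLSpan.incl F hF y‖ (√((JLSpan.coeff F hF y).sum fun _ t => t ^ 2)) := rfl

/-- The defining formula for the norm. -/
theorem JLSpan.norm_equiv (x : cZero) (a : F →₀ ℝ) :
    ‖JLSpan.equiv F hF (x, a)‖ =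
      max ‖(x : EllInfty) + ∑ N ∈ a.support, a N • chi N‖ (√(∑ N ∈ a.support, a N ^ 2)) := by
  rw [JLSpan.norm_def, JLSpan.incl_equiv, JLSpan.coeff_equiv, jlSum_apply, Finsupp.sum]

noncomputable instance : NormedSpace ℝ (JLSpan F hF) where
  norm_smul_le c y := by
    rw [JLSpan.norm_def, JLSpan.norm_def, map_smul, map_smul, norm_smul,
      mul_max_of_nonneg _ _ (norm_nonneg c)]
    refine max_le_max le_rfl (le_of_eq ?_)
    rw [Finsupp.sum_smul_index (by simp), Real.norm_eq_abs, ← Real.sqrt_sq_eq_abs,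
      ← Real.sqrt_mul (sq_nonneg c), Finsupp.mul_sum]
    simp only [mul_pow]

/-- The Johnson-Lindenstrauss space `JL₂(F)`: the completion of `span (c₀ ∪ {χ_N : N ∈ F})` with
respect to the norm above. -/
abbrev JL₂ : Type := UniformSpace.Completion (JLSpan F hF)

end JLSpan

/-! ### Sparse sets -/

/-- The set `A` is sparse with respect to the sequence `m`: the number of elements of `A` below
`m K` is `o(K)`. -/
def IsSparse (m : ℕ → ℕ) (A : Set ℕ) : Prop :=
  Tendsto (fun K : ℕ => ((A ∩ Set.Iio (m K)).ncard : ℝ) / K) atTop (𝓝 0)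

theorem isSparse_empty (m : ℕ → ℕ) : IsSparse m ∅ := by
  simp [IsSparse]

theorem IsSparse.union {m : ℕ → ℕ} {A B : Set ℕ} (hA : IsSparse m A) (hB : IsSparse m B) :
    IsSparse m (A ∪ B) := by
  have h := Tendsto.add hA hB
  rw [add_zero] at h
  refine squeeze_zero (fun K => by positivity) (fun K => ?_) h
  rw [← add_div, Set.union_inter_distrib_right]
  gcongr
  exact_mod_cast Set.ncard_union_le _ _

theorem IsSparse.sUnion {m : ℕ → ℕ} {T : Set (Set ℕ)} (hT : T.Finite)
    (h : ∀ A ∈ T, IsSparse m A) : IsSparse m (⋃₀ T) := by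
  induction T, hT using Set.Finite.induction_on with
  | empty => simpa using isSparse_empty m
  | insert _ _ ih =>
    rw [Set.sUnion_insert]
    exact (h _ (Set.mem_insert _ _)).union (ih fun A hA => h A (Set.mem_insert_of_mem _ hA))

theorem IsSparse.infinite_compl {A : Set ℕ} (h : IsSparse id A) : Aᶜ.Infinite := by
  intro hfin
  obtain ⟨p, hp⟩ := hfin.bddAbove
  have h0 : Tendsto (fun K : ℕ => ((p + 1 : ℕ) : ℝ) / K) atTop (𝓝 0) :=
    tendsto_const_div_atTop_nhds_zero_nat _
  have h1 := Tendsto.add h h0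
  rw [add_zero] at h1
  have h2 : ∀ᶠ K : ℕ in atTop, (1 : ℝ) ≤
      ((A ∩ Set.Iio (id K)).ncard : ℝ) / K + ((p + 1 : ℕ) : ℝ) / K := by
    filter_upwards [eventually_gt_atTop 0] with K hK
    have hK' : (0 : ℝ) < K := by exact_mod_cast hK
    rw [← add_div, one_le_div hK']
    have hsub : Set.Iio K ⊆ (A ∩ Set.Iio K) ∪ Set.Iio (p + 1) := by
      intro j hj
      by_cases hjA : j ∈ A
      · exact Or.inl ⟨hjA, hj⟩
      · exact Or.inr (Nat.lt_succ_of_le (hp hjA))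
    have h3 := Set.ncard_le_ncard hsub
      (((Set.finite_Iio K).subset Set.inter_subset_right).union (Set.finite_Iio (p + 1)))
    have h4 := h3.trans (Set.ncard_union_le _ _)
    have h5 : ∀ q : ℕ, (Set.Iio q).ncard = q := fun q => by
      rw [← Finset.coe_Iio, Set.ncard_coe_finset, Nat.card_Iio]
    rw [h5, h5] at h4
    exact_mod_cast h4
  have := ge_of_tendsto h1 h2
  norm_num at this

theorem exists_infinite_subset_isSparse {X : Set ℕ} (hX : X.Infinite) (m : ℕ → ℕ → ℕ) :
    ∃ A ⊆ X, A.Infinite ∧ ∀ i, IsSparse (m i) A := by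
  have hfreq : ∀ j : ℕ, ∃ᶠ q in atTop, q ∈ X ∧ ∀ i ≤ j, ∀ k ≤ j ^ 2, m i k ≤ q := by
    intro j
    refine (Nat.frequently_atTop_iff_infinite.2 hX).and_eventually ?_
    have h : ∀ i ∈ Set.Iic j, ∀ᶠ q in atTop, ∀ k ∈ Set.Iic (j ^ 2), m i k ≤ q := fun i _ =>
      (eventually_all_finite (Set.finite_Iic _)).2 fun k _ => eventually_ge_atTop _
    exact (eventually_all_finite (Set.finite_Iic j)).2 h
  obtain ⟨n, hn, hnX⟩ := extraction_forall_of_frequently hfreq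
  refine ⟨Set.range n, ?_, Set.infinite_range_of_injective hn.injective, fun i => ?_⟩
  · rintro _ ⟨j, rfl⟩
    exact (hnX j).1
  have hlim : Tendsto (fun K : ℕ => ((i + 1 : ℕ) : ℝ) / K + 1 / √(K : ℝ)) atTop (𝓝 0) := by
    have h1 : Tendsto (fun K : ℕ => ((i + 1 : ℕ) : ℝ) / K) atTop (𝓝 0) :=
      tendsto_const_div_atTop_nhds_zero_nat _
    have h2 : Tendsto (fun K : ℕ => 1 / √(K : ℝ)) atTop (𝓝 0) :=
      tendsto_const_nhds.div_atTop (Real.tendsto_sqrt_atTop.comp tendsto_natCast_atTop_atTop)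
    simpa using h1.add h2
  refine squeeze_zero (fun K => by positivity) (fun K => ?_) hlim
  have hsub : Set.range n ∩ Set.Iio (m i K) ⊆ n '' Set.Iio (i + 1 + K.sqrt) := by
    rintro _ ⟨⟨j, rfl⟩, hj⟩
    refine ⟨j, ?_, rfl⟩
    by_contra hlt
    simp only [Set.mem_Iio, not_lt] at hlt hj
    have hK : K ≤ j ^ 2 := by
      have : K.sqrt < j := by omega
      exact (Nat.sqrt_lt'.1 this).le
    exact absurd ((hnX j).2 i (by omega) K hK) (not_le.2 hj)
  have hcard : (Set.range n ∩ Set.Iio (m i K)).ncard ≤ i + 1 + K.sqrt := by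
    refine (Set.ncard_le_ncard hsub ((Set.finite_Iio _).image n)).trans ?_
    refine (Set.ncard_image_le (Set.finite_Iio _)).trans ?_
    rw [← Finset.coe_Iio, Set.ncard_coe_finset, Nat.card_Iio]
  calc ((Set.range n ∩ Set.Iio (m i K)).ncard : ℝ) / K
      ≤ (((i + 1 : ℕ) : ℝ) + √(K : ℝ)) / K := by
        gcongr
        calc ((Set.range n ∩ Set.Iio (m i K)).ncard : ℝ) ≤ ((i + 1 + K.sqrt : ℕ) : ℝ) := by
              exact_mod_cast hcard
          _ ≤ _ := by
              rw [Nat.cast_add]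
              gcongr
              exact Real.nat_sqrt_le_real_sqrt
    _ = ((i + 1 : ℕ) : ℝ) / K + 1 / √(K : ℝ) := by
        rw [add_div, Real.sqrt_div_self']

/-! ### Summable sequences as set functions -/

/-- The value on `A` of the signed measure on `ℕ` with point masses `μ`. -/
noncomputable def setValue (μ : ℕ → ℝ) (A : Set ℕ) : ℝ := ∑' j, A.indicator μ j

theorem setValue_empty (μ : ℕ → ℝ) : setValue μ ∅ = 0 := by
  simp [setValue]

theorem abs_setValue_le {μ : ℕ → ℝ} (hμ : Summable fun j => |μ j|) (A : Set ℕ) :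
    |setValue μ A| ≤ ∑' j, A.indicator (fun j => |μ j|) j := by
  have h : ∀ j, ‖A.indicator μ j‖ = A.indicator (fun j => |μ j|) j := fun j => by
    rw [norm_indicator_eq_indicator_norm]
    rfl
  have hs : Summable fun j => ‖A.indicator μ j‖ := by
    simp_rw [h]
    exact hμ.indicator A
  exact (norm_tsum_le_tsum_norm hs).trans_eq (tsum_congr h)

theorem abs_setValue_le_tsum {μ : ℕ → ℝ} (hμ : Summable fun j => |μ j|) (A : Set ℕ) :
    |setValue μ A| ≤ ∑' j, |μ j| :=
  (abs_setValue_le hμ A).trans <| (hμ.indicator A).tsum_le_tsum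
    (Set.indicator_le_self' fun _ _ => abs_nonneg _) hμ

/-- A gliding hump: a sequence of summable sequences that converges to `0` pointwise has a
subsequence whose terms are concentrated on successive intervals. -/
theorem exists_gliding_hump {μ : ℕ → ℕ → ℝ} (hs : ∀ n, Summable fun j => |μ n j|)
    (h0 : ∀ j, Tendsto (fun n => μ n j) atTop (𝓝 0)) :
    ∃ (φ m : ℕ → ℕ), StrictMono φ ∧ Monotone m ∧ ∀ k (A : Set ℕ),
      Disjoint A (Set.Ico (m k) (m (k + 1))) → |setValue (μ (φ k)) A| ≤ 2 * (1 / 2) ^ k := by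
  have step : ∀ (k : ℕ) (s : ℕ × ℕ), ∃ t : ℕ × ℕ, s.1 < t.1 ∧ s.2 < t.2 ∧
      ∑ j ∈ Finset.range s.2, |μ t.1 j| ≤ (1 / 2) ^ k ∧ ∑' j, |μ t.1 (j + t.2)| ≤ (1 / 2) ^ k := by
    intro k s
    have hk : (0 : ℝ) < (1 / 2) ^ k := by positivity
    have h1 : Tendsto (fun n => ∑ j ∈ Finset.range s.2, |μ n j|) atTop (𝓝 0) := by
      simpa using tendsto_finsetSum (Finset.range s.2) fun j _ => (h0 j).abs
    obtain ⟨n, hn, hn'⟩ := ((h1.eventually (ge_mem_nhds hk)).and (eventually_gt_atTop s.1)).exists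
    have h2 := tendsto_sum_nat_add fun j => |μ n j|
    obtain ⟨q, hq, hq'⟩ := ((h2.eventually (ge_mem_nhds hk)).and (eventually_gt_atTop s.2)).exists
    exact ⟨(n, q), hn', hq', hn, hq⟩
  choose f hf using step
  let s : ℕ → ℕ × ℕ := fun k => Nat.rec (0, 0) f k
  refine ⟨fun k => (s (k + 1)).1, fun k => (s k).2,
    strictMono_nat_of_lt_succ fun k => (hf (k + 1) (s (k + 1))).1,
    monotone_nat_of_le_succ fun k => (hf k (s k)).2.1.le, fun k A hA => ?_⟩
  obtain ⟨-, -, h3, h4⟩ := hf k (s k)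
  change ∑ j ∈ Finset.range (s k).2, |μ (s (k + 1)).1 j| ≤ _ at h3
  change ∑' j, |μ (s (k + 1)).1 (j + (s (k + 1)).2)| ≤ _ at h4
  change Disjoint A (Set.Ico (s k).2 (s (k + 1)).2) at hA
  have hle : (s k).2 ≤ (s (k + 1)).2 := (hf k (s k)).2.1.le
  have hsum := hs (s (k + 1)).1
  revert h3 h4 hsum hle hA
  generalize μ (s (k + 1)).1 = ν
  generalize (s k).2 = p
  generalize (s (k + 1)).2 = q
  intro h3 h4 hA hle hsum
  refine (abs_setValue_le hsum A).trans ?_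
  rw [← (hsum.indicator A).sum_add_tsum_nat_add q, two_mul]
  refine add_le_add (le_trans ?_ h3) (le_trans ?_ h4)
  · rw [← Finset.sum_subset (Finset.range_mono hle)]
    · exact Finset.sum_le_sum fun j _ => Set.indicator_le_self' (fun _ _ => abs_nonneg _) j
    · intro j hj hj'
      simp only [Finset.mem_range, not_lt] at hj hj'
      exact Set.indicator_of_notMem (fun h => Set.disjoint_left.1 hA h ⟨hj', hj⟩) _
  · exact ((summable_nat_add_iff q).2 (hsum.indicator A)).tsum_le_tsum
      (fun j => Set.indicator_le_self' (fun _ _ => abs_nonneg _) _)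
      ((summable_nat_add_iff q).2 hsum)

/-- The averages of a bounded sequence of measures concentrated on successive intervals
converge to `0` on every sparse set. -/
theorem IsSparse.tendsto_average {m : ℕ → ℕ} (hm : Monotone m) {A : Set ℕ} (hA : IsSparse m A)
    {u : ℕ → ℝ} {C : ℝ} (hC : ∀ k, |u k| ≤ C)
    (hu : ∀ k, Disjoint A (Set.Ico (m k) (m (k + 1))) → |u k| ≤ 2 * (1 / 2) ^ k) :
    Tendsto (fun K : ℕ => (K : ℝ)⁻¹ * ∑ k ∈ Finset.range K, u k) atTop (𝓝 0) := by
  classical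
  have hC0 : 0 ≤ C := (abs_nonneg _).trans (hC 0)
  have h1 : Tendsto (fun k : ℕ => 2 * (1 / 2 : ℝ) ^ k) atTop (𝓝 0) := by
    simpa using (tendsto_pow_atTop_nhds_zero_of_lt_one (r := (1 / 2 : ℝ)) (by norm_num)
      (by norm_num)).const_mul 2
  have h2 := h1.cesaro.add (Tendsto.const_mul C hA)
  rw [mul_zero, add_zero] at h2
  refine squeeze_zero_norm (fun K => ?_) h2
  rw [norm_mul, Real.norm_eq_abs, abs_of_nonneg (by positivity), div_eq_inv_mul _ (K : ℝ),
    mul_left_comm C, ← mul_add]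
  gcongr
  set S := (Finset.range K).filter fun k => ¬ Disjoint A (Set.Ico (m k) (m (k + 1))) with hS
  have hcard : S.card ≤ (A ∩ Set.Iio (m K)).ncard := by
    have hex : ∀ k ∈ S, ∃ a, a ∈ A ∩ Set.Iio (m K) ∧ a ∈ Set.Ico (m k) (m (k + 1)) := by
      intro k hk
      rw [hS, Finset.mem_filter, Finset.mem_range] at hk
      obtain ⟨a, ha, ha'⟩ := Set.not_disjoint_iff.1 hk.2
      exact ⟨a, ⟨ha, ha'.2.trans_le (hm hk.1)⟩, ha'⟩
    choose! f hf hf' using hex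
    rw [← Set.ncard_coe_finset]
    refine Set.ncard_le_ncard_of_injOn f hf ?_ ((Set.finite_Iio _).subset Set.inter_subset_right)
    intro k hk l hl hkl
    have e1 := hf' k hk
    have e2 := hf' l hl
    rw [hkl] at e1
    by_contra hne
    rcases lt_or_gt_of_ne hne with h | h
    · exact absurd (e1.2.trans_le ((hm (Nat.succ_le_of_lt h)).trans e2.1)) (lt_irrefl _)
    · exact absurd (e2.2.trans_le ((hm (Nat.succ_le_of_lt h)).trans e1.1)) (lt_irrefl _)
  calc ‖∑ k ∈ Finset.range K, u k‖ ≤ ∑ k ∈ Finset.range K, ‖u k‖ := norm_sum_le _ _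
    _ ≤ ∑ k ∈ Finset.range K, (2 * (1 / 2 : ℝ) ^ k +
          if ¬ Disjoint A (Set.Ico (m k) (m (k + 1))) then C else 0) := by
        refine Finset.sum_le_sum fun k _ => ?_
        have hp : (0 : ℝ) ≤ 2 * (1 / 2) ^ k := by positivity
        by_cases hd : Disjoint A (Set.Ico (m k) (m (k + 1)))
        · simpa [hd] using hu k hd
        · simp only [hd, not_false_eq_true, if_true]
          exact (hC k).trans (le_add_of_nonneg_left hp)
    _ = (∑ k ∈ Finset.range K, 2 * (1 / 2 : ℝ) ^ k) + C * S.card := by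
        rw [Finset.sum_add_distrib, ← Finset.sum_filter, Finset.sum_const, nsmul_eq_mul, mul_comm C]
    _ ≤ _ := by gcongr

/-! ### Transfinite recursion of length `ω₁` -/

/-- Transfinite recursion in relational form. -/
theorem exists_transfinite_recursion {W α : Type*} [LinearOrder W] [WellFoundedLT W] [Nonempty α]
    (R : W → (W → α) → α → Prop)
    (hcongr : ∀ β N N' A, (∀ γ < β, N γ = N' γ) → R β N A → R β N' A)
    (hex : ∀ β N, ∃ A, R β N A) : ∃ N : W → α, ∀ β, R β N (N β) := by
  classical
  choose F hF using hex
  let d : α := Classical.arbitrary α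
  let N : W → α := (wellFounded_lt (α := W)).fix fun β ih =>
    F β fun γ => if h : γ < β then ih γ h else d
  refine ⟨N, fun β => ?_⟩
  have h : N β = F β fun γ => if γ < β then N γ else d := by
    simp only [N]
    rw [WellFounded.fix_eq]
    congr
  rw [h]
  exact hcongr _ _ _ _ (fun γ hγ => if_pos hγ) (hF β _)

theorem exists_wellOrder_of_continuum_eq_aleph_one
    (CH : Cardinal.continuum.{0} = Cardinal.aleph 1) :
    ∃ (W : Type) (_ : LinearOrder W) (_ : WellFoundedLT W),
      Cardinal.mk W = Cardinal.continuum ∧ (∀ β : W, (Set.Iic β).Countable) ∧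
      ∀ S : Set W, S.Countable → ∃ δ, ∀ β ∈ S, β < δ := by
  have hIio : ∀ β : (Cardinal.aleph.{0} 1).ord.ToType, (Set.Iio β).Countable := fun β => by
    rw [← Cardinal.le_aleph0_iff_set_countable, ← Cardinal.lt_aleph_one_iff]
    simpa using Cardinal.mk_Iio_lt β (by simp)
  have hIic : ∀ β : (Cardinal.aleph.{0} 1).ord.ToType, (Set.Iic β).Countable := fun β => by
    rw [← Set.Iio_insert]
    exact (hIio β).insert β
  refine ⟨(Cardinal.aleph.{0} 1).ord.ToType, inferInstance, inferInstance, ?_, hIic, ?_⟩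
  · rw [Cardinal.mk_ord_toType, CH]
  · intro S hS
    by_contra! hcon
    have hU : (⋃ β ∈ S, Set.Iic β) = Set.univ := Set.eq_univ_of_forall fun δ => by
      obtain ⟨β, hβ, hβ'⟩ := hcon δ
      exact Set.mem_biUnion hβ hβ'
    have hc : (Set.univ : Set (Cardinal.aleph.{0} 1).ord.ToType).Countable := by
      rw [← hU]
      exact hS.biUnion fun β _ => hIic β
    rw [← Cardinal.le_aleph0_iff_set_countable, Cardinal.mk_univ, Cardinal.mk_ord_toType,
      ← Cardinal.lt_aleph_one_iff] at hc
    exact lt_irrefl _ hc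

theorem exists_surjective_of_mk_le {α β : Type} [Nonempty β]
    (h : Cardinal.mk β ≤ Cardinal.mk α) : ∃ f : α → β, Function.Surjective f := by
  obtain ⟨e⟩ := Cardinal.le_def _ _ |>.1 h
  exact ⟨_, Function.invFun_surjective e.injective⟩

/-! ### The dual of the Johnson-Lindenstrauss space -/

/-- The unit vector `e_j` of `c₀`. -/
noncomputable def cZeroUnit (j : ℕ) : cZero :=
  ⟨(lp.single ∞ j (1 : ℝ) : EllInfty), by
    change Tendsto (fun n => (lp.single ∞ j (1 : ℝ) : EllInfty) n) atTop (𝓝 0)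
    refine tendsto_const_nhds.congr' ?_
    filter_upwards [eventually_gt_atTop j] with n hn
    rw [lp.single_apply, Pi.single_eq_of_ne hn.ne']⟩

theorem cZeroUnit_apply (j n : ℕ) : (cZeroUnit j : EllInfty) n = if n = j then 1 else 0 := by
  change (lp.single ∞ j (1 : ℝ) : EllInfty) n = _
  rw [lp.single_apply, Pi.single_apply]

theorem sum_smul_cZeroUnit_apply (s : Finset ℕ) (f : ℕ → ℝ) (n : ℕ) :
    ((∑ j ∈ s, f j • cZeroUnit j : cZero) : EllInfty) n = if n ∈ s then f n else 0 := by
  have h : ((∑ j ∈ s, f j • cZeroUnit j : cZero) : EllInfty) n =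
      ∑ j ∈ s, f j * (cZeroUnit j : EllInfty) n := by
    induction s using Finset.cons_induction with
    | empty => simp
    | cons a s ha ih =>
      rw [Finset.sum_cons, Finset.sum_cons, ← ih]
      rfl
  rw [h]
  simp [cZeroUnit_apply]

section Dual

variable {F : Set (Set ℕ)} {hF : IsAlmostDisjoint F}

theorem jlSum_zero_apply (a : F →₀ ℝ) (n : ℕ) :
    jlSum F (0, a) n = ∑ N ∈ a.support, a N * chi N n := by
  rw [jlSum_apply, Submodule.coe_zero, zero_add, lp.coeFn_sum, Finset.sum_apply]
  rfl

theorem eventually_abs_jlSum_zero_le (hF : IsAlmostDisjoint F) (a : F →₀ ℝ) :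
    ∀ᶠ n in atTop, |jlSum F (0, a) n| ≤ √(a.sum fun _ t => t ^ 2) := by
  have hpair : ∀ᶠ n in atTop, ∀ M ∈ a.support, ∀ N ∈ a.support, M ≠ N →
      ¬ (n ∈ (M : Set ℕ) ∧ n ∈ (N : Set ℕ)) := by
    refine (eventually_all_finset _).2 fun M _ => (eventually_all_finset _).2 fun N _ => ?_
    by_cases h : M = N
    · simp [h]
    · have hfin := hF.2 M M.2 N N.2 fun h' => h (Subtype.ext h')
      rw [← Nat.cofinite_eq_atTop]
      filter_upwards [hfin.compl_mem_cofinite] with n hn _ hn'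
      exact hn hn'
  filter_upwards [hpair] with n hn
  rw [jlSum_zero_apply]
  by_cases hex : ∃ M ∈ a.support, n ∈ (M : Set ℕ)
  · obtain ⟨M, hM, hnM⟩ := hex
    rw [Finset.sum_eq_single M]
    · rw [chi_apply, Set.indicator_of_mem hnM, mul_one]
      refine Real.abs_le_sqrt ?_
      exact Finset.single_le_sum (f := fun N => a N ^ 2) (fun N _ => sq_nonneg _) hM
    · intro N hN hNM
      rw [chi_apply, Set.indicator_of_notMem (fun h => hn N hN M hM hNM ⟨h, hnM⟩), mul_zero]
    · exact fun h => absurd hM h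
  · push Not at hex
    rw [Finset.sum_eq_zero]
    · simp
    · intro N hN
      rw [chi_apply, Set.indicator_of_notMem (hex N hN), mul_zero]

variable (hF) in
/-- The vector `e_j` of `JL₂(F)`. -/
noncomputable def jlUnit (j : ℕ) : JL₂ F hF :=
  ((JLSpan.equiv F hF (cZeroUnit j, 0) : JLSpan F hF) : JL₂ F hF)

variable (hF) in
/-- The vector `χ_N` of `JL₂(F)`. -/
noncomputable def jlChi (N : F) : JL₂ F hF :=
  ((JLSpan.equiv F hF (0, Finsupp.single N 1) : JLSpan F hF) : JL₂ F hF)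

variable (hF) in
/-- The linear map `(x, a) ↦ x + ∑_{N ∈ F} a_N χ_N` into `JL₂(F)`. -/
noncomputable def jlMap : cZero × (F →₀ ℝ) →ₗ[ℝ] JL₂ F hF :=
  (UniformSpace.Completion.toComplL (𝕜 := ℝ) (E := JLSpan F hF)).toLinearMap.comp
    (JLSpan.equiv F hF).toLinearMap

theorem jlMap_apply (p : cZero × (F →₀ ℝ)) :
    jlMap hF p = ((JLSpan.equiv F hF p : JLSpan F hF) : JL₂ F hF) := rfl

theorem norm_jlMap (p : cZero × (F →₀ ℝ)) :
    ‖jlMap hF p‖ = max ‖jlSum F p‖ (√(p.2.sum fun _ t => t ^ 2)) := by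
  rw [jlMap_apply, UniformSpace.Completion.norm_coe, JLSpan.norm_def, JLSpan.incl_equiv]
  obtain ⟨x, a⟩ := p
  rw [JLSpan.coeff_equiv]

theorem jlMap_sum_smul_unit (s : Finset ℕ) (f : ℕ → ℝ) :
    jlMap hF (∑ j ∈ s, f j • cZeroUnit j, 0) = ∑ j ∈ s, f j • jlUnit hF j := by
  have h : ((∑ j ∈ s, f j • cZeroUnit j, 0) : cZero × (F →₀ ℝ)) =
      LinearMap.inl ℝ cZero (F →₀ ℝ) (∑ j ∈ s, f j • cZeroUnit j) := rfl
  rw [h, map_sum, map_sum]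
  refine Finset.sum_congr rfl fun j _ => ?_
  rw [map_smul, map_smul]
  rfl

theorem jlMap_zero_eq_sum (a : F →₀ ℝ) :
    jlMap hF (0, a) = ∑ N ∈ a.support, a N • jlChi hF N := by
  have h : ((0, a) : cZero × (F →₀ ℝ)) = LinearMap.inr ℝ cZero (F →₀ ℝ) a := rfl
  rw [h]
  nth_rw 1 [← Finsupp.sum_single a]
  rw [Finsupp.sum, map_sum, map_sum]
  refine Finset.sum_congr rfl fun N _ => ?_
  rw [← Finsupp.smul_single_one, map_smul, map_smul]
  rfl

theorem jlMap_eq_add (x : cZero) (a : F →₀ ℝ) :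
    jlMap hF (x, a) = jlMap hF (x, 0) + jlMap hF (0, a) := by
  rw [← map_add]
  simp

theorem norm_jlMap_zero_right (x : cZero) : ‖jlMap hF (x, 0)‖ = ‖(x : EllInfty)‖ := by
  rw [norm_jlMap, jlSum_apply]
  simp

/-- The values of a functional at the unit vectors are absolutely summable. -/
theorem summable_abs_apply_jlUnit (x : StrongDual ℝ (JL₂ F hF)) :
    (Summable fun j => |x (jlUnit hF j)|) ∧ ∑' j, |x (jlUnit hF j)| ≤ ‖x‖ := by
  have hle : ∀ s : Finset ℕ, ∑ j ∈ s, |x (jlUnit hF j)| ≤ ‖x‖ := by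
    intro s
    let f : ℕ → ℝ := fun j => SignType.sign (x (jlUnit hF j))
    have h1 : ∑ j ∈ s, |x (jlUnit hF j)| = x (jlMap hF (∑ j ∈ s, f j • cZeroUnit j, 0)) := by
      rw [jlMap_sum_smul_unit, map_sum]
      refine Finset.sum_congr rfl fun j _ => ?_
      rw [map_smul, smul_eq_mul, sign_mul_self]
    have h2 : ‖jlMap hF (∑ j ∈ s, f j • cZeroUnit j, 0)‖ ≤ 1 := by
      rw [norm_jlMap_zero_right]
      refine lp.norm_le_of_forall_le zero_le_one fun n => ?_
      rw [sum_smul_cZeroUnit_apply]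
      split_ifs
      · rcases lt_trichotomy (x (jlUnit hF n)) 0 with h | h | h <;> simp [f, h]
      · simp
    rw [h1]
    refine (le_abs_self _).trans ((x.le_opNorm _).trans ?_)
    exact mul_le_of_le_one_right (norm_nonneg _) h2
  have hs := summable_of_sum_le (fun _ => abs_nonneg _) hle
  exact ⟨hs, hs.tsum_le_of_sum_le hle⟩

/-- The difference between the value of `x` at `χ_N` and the value on `N` of the measure that
`x` induces on `ℕ`. -/
noncomputable def jlDefect (x : StrongDual ℝ (JL₂ F hF)) (N : F) : ℝ :=
  x (jlChi hF N) - setValue (fun j => x (jlUnit hF j)) N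

theorem abs_sum_mul_jlDefect_le (x : StrongDual ℝ (JL₂ F hF)) (a : F →₀ ℝ) :
    |∑ N ∈ a.support, a N * jlDefect x N| ≤ ‖x‖ * √(a.sum fun _ t => t ^ 2) := by
  let g : ℕ → ℝ := fun j => jlSum F (0, a) j
  let v : ℕ → JL₂ F hF := fun p =>
    jlMap hF (∑ j ∈ Finset.range p, (-g j) • cZeroUnit j, a)
  have hv : ∀ p, x (v p) = ∑ N ∈ a.support, a N *
      (x (jlChi hF N) - ∑ j ∈ Finset.range p,
        (N : Set ℕ).indicator (fun j => x (jlUnit hF j)) j) := by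
    intro p
    simp only [v]
    rw [jlMap_eq_add, jlMap_sum_smul_unit, jlMap_zero_eq_sum, map_add, map_sum, map_sum]
    simp only [map_smul, smul_eq_mul, mul_sub, Finset.sum_sub_distrib, Finset.mul_sum]
    rw [Finset.sum_comm, add_comm, sub_eq_add_neg, ← Finset.sum_neg_distrib]
    congr 1
    refine Finset.sum_congr rfl fun j _ => ?_
    simp only [g]
    rw [jlSum_zero_apply, neg_mul, Finset.sum_mul]
    congr 1
    refine Finset.sum_congr rfl fun N _ => ?_
    by_cases h : j ∈ (N : Set ℕ) <;> simp [chi_apply, h]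
  have hlim : Tendsto (fun p => x (v p)) atTop (𝓝 (∑ N ∈ a.support, a N * jlDefect x N)) := by
    simp_rw [hv]
    refine tendsto_finsetSum _ fun N _ => (tendsto_const_nhds.sub ?_).const_mul _
    exact ((summable_abs_apply_jlUnit x).1.of_abs.indicator _).hasSum.tendsto_sum_nat
  refine le_of_tendsto hlim.abs ?_
  obtain ⟨p₀, hp₀⟩ := eventually_atTop.1 (eventually_abs_jlSum_zero_le hF a)
  filter_upwards [eventually_ge_atTop p₀] with p hp
  refine (x.le_opNorm _).trans (mul_le_mul_of_nonneg_left ?_ (norm_nonneg _))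
  rw [norm_jlMap]
  refine max_le (lp.norm_le_of_forall_le (Real.sqrt_nonneg _) fun n => ?_) le_rfl
  have e : jlSum F (∑ j ∈ Finset.range p, (-g j) • cZeroUnit j, a) n =
      (if n ∈ Finset.range p then -g n else 0) + g n := by
    have h1 := sum_smul_cZeroUnit_apply (Finset.range p) (fun j => -g j) n
    rw [← h1]
    simp only [g]
    rw [jlSum_apply, jlSum_apply, Submodule.coe_zero, zero_add]
    rfl
  rw [e]
  split_ifs with h
  · simp
  · rw [zero_add]
    exact hp₀ n (hp.trans (by simpa using h))

theorem countable_support_jlDefect (x : StrongDual ℝ (JL₂ F hF)) :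
    (Function.support (jlDefect x)).Countable := by
  classical
  have hle : ∀ s : Finset F, ∑ N ∈ s, jlDefect x N ^ 2 ≤ ‖x‖ ^ 2 := by
    intro s
    let a : F →₀ ℝ := Finsupp.indicator s fun N _ => jlDefect x N
    have ha : ∀ N ∈ s, a N = jlDefect x N := fun N hN => Finsupp.indicator_of_mem hN _
    have hsupp : a.support ⊆ s := Finsupp.support_indicator_subset _ _
    have h := abs_sum_mul_jlDefect_le x a
    have h1 : ∑ N ∈ a.support, a N * jlDefect x N = ∑ N ∈ s, jlDefect x N ^ 2 := by
      rw [Finset.sum_subset hsupp]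
      · exact Finset.sum_congr rfl fun N hN => by rw [ha N hN, sq]
      · intro N _ hN
        rw [Finsupp.notMem_support_iff.1 hN, zero_mul]
    have h2 : (a.sum fun _ t => t ^ 2) = ∑ N ∈ s, jlDefect x N ^ 2 := by
      rw [Finsupp.sum_of_support_subset a hsupp _ (by simp)]
      exact Finset.sum_congr rfl fun N hN => by rw [ha N hN]
    rw [h1, h2] at h
    set t := ∑ N ∈ s, jlDefect x N ^ 2
    have ht : 0 ≤ t := Finset.sum_nonneg fun _ _ => sq_nonneg _
    rw [abs_of_nonneg ht] at h
    have h3 := Real.sq_sqrt ht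
    have h4 := Real.sqrt_nonneg t
    have h5 : √t ≤ ‖x‖ := by
      by_contra! hlt
      nlinarith [norm_nonneg x]
    rw [← h3]
    gcongr
  have hs := (summable_of_sum_le (fun _ => sq_nonneg _) hle).countable_support
  refine hs.mono fun N hN => ?_
  simpa using hN

/-- The unit vectors and the characteristic functions span a dense subspace. -/
theorem dense_span_jlUnit_jlChi (hF : IsAlmostDisjoint F) :
    Dense (Submodule.span ℝ (Set.range (jlUnit hF) ∪ Set.range (jlChi hF)) : Set (JL₂ F hF)) := by
  set S := Submodule.span ℝ (Set.range (jlUnit hF) ∪ Set.range (jlChi hF)) with hS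
  have hunit : ∀ j, jlUnit hF j ∈ S := fun j => Submodule.subset_span (Or.inl ⟨j, rfl⟩)
  have hchi : ∀ N, jlChi hF N ∈ S := fun N => Submodule.subset_span (Or.inr ⟨N, rfl⟩)
  have hcl : ∀ y : JLSpan F hF, (y : JL₂ F hF) ∈ closure (S : Set (JL₂ F hF)) := by
    intro y
    obtain ⟨⟨x, a⟩, rfl⟩ := (JLSpan.equiv F hF).surjective y
    rw [← jlMap_apply, jlMap_eq_add, ← Submodule.topologicalClosure_coe]
    refine add_mem ?_ (Submodule.le_topologicalClosure S ?_)
    · change _ ∈ closure (S : Set (JL₂ F hF))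
      rw [Metric.mem_closure_iff]
      intro ε hε
      have hx : Tendsto (fun n => (x : EllInfty) n) atTop (𝓝 0) := x.2
      obtain ⟨p, hp⟩ := eventually_atTop.1 (Metric.tendsto_nhds.1 hx (ε / 2) (half_pos hε))
      refine ⟨jlMap hF (∑ j ∈ Finset.range p, (x : EllInfty) j • cZeroUnit j, 0), ?_, ?_⟩
      · rw [jlMap_sum_smul_unit]
        exact sum_mem fun j _ => S.smul_mem _ (hunit j)
      · rw [dist_eq_norm, ← map_sub, Prod.mk_sub_mk, sub_zero, norm_jlMap_zero_right]
        refine lt_of_le_of_lt (lp.norm_le_of_forall_le (half_pos hε).le fun n => ?_)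
          (half_lt_self hε)
        rw [Submodule.coe_sub, lp.coeFn_sub, Pi.sub_apply, sum_smul_cZeroUnit_apply]
        split_ifs with h
        · simpa using (half_pos hε).le
        · have := hp n (by simpa using h)
          rw [dist_zero_right] at this
          simpa using this.le
    · rw [jlMap_zero_eq_sum]
      exact sum_mem fun N _ => S.smul_mem _ (hchi N)
  intro z
  have hz : z ∈ closure (Set.range ((↑) : JLSpan F hF → JL₂ F hF)) :=
    UniformSpace.Completion.denseRange_coe z
  exact closure_minimal (by rintro _ ⟨y, rfl⟩; exact hcl y) isClosed_closure hz

end Dual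

section WeakStar

variable {E : Type*} [NormedAddCommGroup E] [NormedSpace ℝ E]

/-- A bounded sequence of functionals that converges to `0` on a set with dense span converges
to `0` in the weak* topology. -/
theorem tendsto_toWeakDual_zero_of_dense_span {y : ℕ → StrongDual ℝ E} {C : ℝ}
    (hC : ∀ n, ‖y n‖ ≤ C) {T : Set E} (hT : Dense (Submodule.span ℝ T : Set E))
    (h : ∀ t ∈ T, Tendsto (fun n => y n t) atTop (𝓝 0)) :
    Tendsto (fun n => StrongDual.toWeakDual (y n)) atTop (𝓝 (0 : WeakDual ℝ E)) := by
  rw [tendsto_iff_forall_eval_tendsto_topDualPairing]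
  intro z
  change Tendsto (fun n => y n z) atTop (𝓝 0)
  have hspan : ∀ w ∈ Submodule.span ℝ T, Tendsto (fun n => y n w) atTop (𝓝 0) := by
    intro w hw
    induction hw using Submodule.span_induction with
    | mem t ht => exact h t ht
    | zero => simp
    | add u v _ _ hu hv => simpa using hu.add hv
    | smul c u _ hu => simpa using hu.const_mul c
  have hC0 : 0 ≤ C := (norm_nonneg _).trans (hC 0)
  rw [Metric.tendsto_nhds]
  intro ε hε
  obtain ⟨w, hw, hzw⟩ := Metric.dense_iff.1 hT z (ε / (2 * (C + 1))) (by positivity)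
  filter_upwards [Metric.tendsto_nhds.1 (hspan w hzw) (ε / 2) (half_pos hε)] with n hn
  rw [dist_zero_right] at hn ⊢
  have h1 : ‖y n (z - w)‖ < ε / 2 := by
    have h2 : ‖z - w‖ < ε / (2 * (C + 1)) := by
      rw [← dist_eq_norm, dist_comm]
      exact hw
    calc ‖y n (z - w)‖ ≤ ‖y n‖ * ‖z - w‖ := (y n).le_opNorm _
      _ ≤ (C + 1) * ‖z - w‖ := by
        gcongr
        exact (hC n).trans (by linarith)
      _ < (C + 1) * (ε / (2 * (C + 1))) := by gcongr
      _ = ε / 2 := by field_simp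
  calc ‖y n z‖ = ‖y n (z - w) + y n w‖ := by rw [← map_add, sub_add_cancel]
    _ ≤ ‖y n (z - w)‖ + ‖y n w‖ := norm_add_le _ _
    _ < ε := by linarith

/-- If `0` is a weak* cluster point of a sequence of functionals, then a subsequence converges
to `0` on a given countable set. -/
theorem exists_subseq_tendsto_zero_of_mapClusterPt {x : ℕ → StrongDual ℝ E}
    (hx : MapClusterPt (0 : WeakDual ℝ E) atTop fun n => StrongDual.toWeakDual (x n))
    {T : Set E} (hT : T.Countable) :
    ∃ φ : ℕ → ℕ, StrictMono φ ∧ ∀ t ∈ T, Tendsto (fun k => x (φ k) t) atTop (𝓝 0) := by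
  rcases T.eq_empty_or_nonempty with rfl | hne
  · exact ⟨id, strictMono_id, by simp⟩
  obtain ⟨t, rfl⟩ := hT.exists_eq_range hne
  have hfreq : ∀ k : ℕ, ∃ᶠ n in atTop, ∀ i ≤ k, |x n (t i)| < 1 / ((k : ℝ) + 1) := by
    intro k
    have hU : {f : WeakDual ℝ E | ∀ i ∈ Set.Iic k, |f (t i)| < 1 / ((k : ℝ) + 1)} ∈
        𝓝 (0 : WeakDual ℝ E) := by
      change ∀ᶠ f in 𝓝 (0 : WeakDual ℝ E), ∀ i ∈ Set.Iic k, |f (t i)| < 1 / ((k : ℝ) + 1)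
      refine (eventually_all_finite (Set.finite_Iic k)).2 fun i _ => ?_
      have hcont : Continuous fun f : WeakDual ℝ E => |f (t i)| :=
        (WeakDual.eval_continuous (t i)).abs
      refine hcont.continuousAt.eventually_lt continuousAt_const ?_
      change |(0 : ℝ)| < _
      rw [abs_zero]
      positivity
    exact hx.frequently hU
  obtain ⟨φ, hφ, hφ'⟩ := extraction_forall_of_frequently hfreq
  refine ⟨φ, hφ, ?_⟩
  rintro _ ⟨i, rfl⟩
  refine squeeze_zero_norm' ?_ tendsto_one_div_add_atTop_nhds_zero_nat
  filter_upwards [eventually_ge_atTop i] with k hk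
  exact (hφ' k i hk).le

end WeakStar

/-! ### The family -/

/-- Along a subsequence, the functionals coded by `μ` and `d` converge to `0` on the tests `d` and
on the sets `N β`, `δ ≤ β < γ`, and the measures `μ` are concentrated on the successive intervals
with end points `m k`. -/
def IsHumpScale {W : Type*} [LinearOrder W] (c : (ℕ → ℕ → ℝ) × W × (ℕ → ℕ → ℝ)) (γ : W)
    (N : W → Set ℕ) (m : ℕ → ℕ) : Prop :=
  Monotone m ∧ ∃ φ : ℕ → ℕ, StrictMono φ ∧
    (∀ j, Tendsto (fun k => c.2.2 (φ k) j) atTop (𝓝 0)) ∧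
    (∀ β < γ, c.2.1 ≤ β → Tendsto (fun k => setValue (c.1 (φ k)) (N β)) atTop (𝓝 0)) ∧
    ∀ k (A : Set ℕ), Disjoint A (Set.Ico (m k) (m (k + 1))) →
      |setValue (c.1 (φ k)) A| ≤ 2 * (1 / 2) ^ k

theorem isHumpScale_congr {W : Type*} [LinearOrder W] (c : (ℕ → ℕ → ℝ) × W × (ℕ → ℕ → ℝ)) {γ : W}
    {N N' : W → Set ℕ} (h : ∀ β < γ, N β = N' β) : IsHumpScale c γ N = IsHumpScale c γ N' := by
  funext m
  have h1 : ∀ φ : ℕ → ℕ,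
      (∀ β < γ, c.2.1 ≤ β → Tendsto (fun k => setValue (c.1 (φ k)) (N β)) atTop (𝓝 0)) ↔
      (∀ β < γ, c.2.1 ≤ β → Tendsto (fun k => setValue (c.1 (φ k)) (N' β)) atTop (𝓝 0)) :=
    fun φ => forall₂_congr fun β hβ => by rw [h β hβ]
  simp only [IsHumpScale, h1]

/-- Let `W` be a well-order of the cardinality of the continuum with countable initial segments.
Then there is a MAD family, indexed by `W` up to repetitions of the empty set, whose members are
sparse with respect to all scales defined at earlier stages. -/
theorem exists_sparse_family {W : Type} [LinearOrder W] [WellFoundedLT W]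
    (hW : Cardinal.mk W = Cardinal.continuum) (hcount : ∀ β : W, (Set.Iic β).Countable) :
    ∃ (N : W → Set ℕ) (g : W → (ℕ → ℕ → ℝ) × W × (ℕ → ℕ → ℝ)) (M : W → W → ℕ → ℕ),
      Function.Surjective g ∧
      (∀ β, (N β).Infinite ∨ N β = ∅) ∧
      (∀ β γ, γ < β → (N β ∩ N γ).Finite) ∧
      (∀ X : Set ℕ, X.Infinite → ∃ β, (X ∩ N β).Infinite) ∧
      (∀ β, IsSparse id (N β)) ∧
      (∀ i γ, (∃ m, IsHumpScale (g i) γ N m) → IsHumpScale (g i) γ N (M i γ)) ∧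
      ∀ β, ∀ i ≤ β, ∀ γ ≤ β, IsSparse (M i γ) (N β) := by
  classical
  have hne : Nonempty W := by
    rw [← Cardinal.mk_ne_zero_iff, hW]
    exact Cardinal.continuum_ne_zero
  obtain ⟨g, hg⟩ : ∃ g : W → (ℕ → ℕ → ℝ) × W × (ℕ → ℕ → ℝ), Function.Surjective g :=
    exists_surjective_of_mk_le (by simp [hW, Cardinal.mk_real])
  obtain ⟨X, hX⟩ : ∃ X : W → Set ℕ, Function.Surjective X :=
    exists_surjective_of_mk_le (by simp [hW])
  let M : W → W → (W → Set ℕ) → ℕ → ℕ := fun i γ N => Classical.epsilon (IsHumpScale (g i) γ N)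
  have hM : ∀ i γ N N', (∀ β < γ, N β = N' β) → M i γ N = M i γ N' := fun i γ N N' h => by
    simp only [M, isHumpScale_congr (g i) h]
  let R : W → (W → Set ℕ) → Set ℕ → Prop := fun β N A =>
    (A.Infinite ∧ A ⊆ X β ∧ (∀ γ < β, (X β ∩ N γ).Finite) ∨
      A = ∅ ∧ ¬ ((X β).Infinite ∧ ∀ γ < β, (X β ∩ N γ).Finite)) ∧
    IsSparse id A ∧ ∀ i ≤ β, ∀ γ ≤ β, IsSparse (M i γ N) A
  obtain ⟨N, hN⟩ : ∃ N : W → Set ℕ, ∀ β, R β N (N β) := by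
    refine exists_transfinite_recursion R ?_ ?_
    · intro β N N' A h hR
      have h1 : (∀ γ < β, (X β ∩ N γ).Finite) ↔ ∀ γ < β, (X β ∩ N' γ).Finite :=
        forall₂_congr fun γ hγ => by rw [h γ hγ]
      refine ⟨by simpa only [h1] using hR.1, hR.2.1, fun i hi γ hγ => ?_⟩
      rw [← hM i γ N N' fun β' hβ' => h β' (hβ'.trans_le hγ)]
      exact hR.2.2 i hi γ hγ
    · intro β N
      by_cases hβ : (X β).Infinite ∧ ∀ γ < β, (X β ∩ N γ).Finite
      · have hc : (insert id ((fun p : W × W => M p.1 p.2 N) ''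
            (Set.Iic β ×ˢ Set.Iic β))).Countable :=
          (((hcount β).prod (hcount β)).image _).insert _
        obtain ⟨e, he⟩ := hc.exists_eq_range (Set.insert_nonempty _ _)
        obtain ⟨A, hAX, hA, hAs⟩ := exists_infinite_subset_isSparse hβ.1 e
        have hs : ∀ m ∈ insert id ((fun p : W × W => M p.1 p.2 N) ''
            (Set.Iic β ×ˢ Set.Iic β)), IsSparse m A := by
          rw [he]
          rintro _ ⟨i, rfl⟩
          exact hAs i
        exact ⟨A, Or.inl ⟨hA, hAX, hβ.2⟩, hs _ (Set.mem_insert _ _), fun i hi γ hγ =>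
          hs _ (Set.mem_insert_of_mem _ ⟨(i, γ), ⟨hi, hγ⟩, rfl⟩)⟩
      · exact ⟨∅, Or.inr ⟨rfl, hβ⟩, isSparse_empty _, fun i _ γ _ => isSparse_empty _⟩
  refine ⟨N, g, fun i γ => M i γ N, hg, fun β => (hN β).1.imp (·.1) (·.1), fun β γ hγ => ?_,
    fun Y hY => ?_, fun β => (hN β).2.1, fun i γ h => Classical.epsilon_spec h,
    fun β => (hN β).2.2⟩
  · rcases (hN β).1 with h | h
    · exact (h.2.2 γ hγ).subset (Set.inter_subset_inter_left _ h.2.1)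
    · simp [h.1]
  · obtain ⟨β, rfl⟩ := hX Y
    rcases (hN β).1 with h | h
    · exact ⟨β, by rw [Set.inter_eq_right.2 h.2.1]; exact h.1⟩
    · have h2 := h.2
      push Not at h2
      obtain ⟨γ, -, hγ⟩ := h2 hY
      exact ⟨γ, hγ⟩

/-- An almost disjoint family is maximal if each infinite set has an infinite intersection with
one of its members. -/
theorem isMADFamily_of_forall_infinite_inter {F : Set (Set ℕ)} (hF : IsAlmostDisjoint F)
    (h : ∀ X : Set ℕ, X.Infinite → ∃ N ∈ F, (X ∩ N).Infinite) : IsMADFamily F := by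
  refine ⟨hF, fun G hG hFG X hX => ?_⟩
  obtain ⟨N, hN, hXN⟩ := h X (hG.1 X hX)
  by_contra hXF
  exact hXN (hG.2 X hX N (hFG hN) fun hXN' => hXF (hXN' ▸ hN))

theorem IsMADFamily.infinite_of_isSparse {F : Set (Set ℕ)} (hF : IsMADFamily F)
    (hs : ∀ N ∈ F, IsSparse id N) : F.Infinite := by
  intro hfin
  have hinf : (⋃₀ F)ᶜ.Infinite := (IsSparse.sUnion hfin hs).infinite_compl
  have hdisj : ∀ N ∈ F, (⋃₀ F)ᶜ ∩ N = ∅ := fun N hN => by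
    ext n
    simp only [Set.mem_inter_iff, Set.mem_compl_iff, Set.mem_empty_iff_false, iff_false, not_and]
    exact fun h hn => absurd ⟨N, hN, hn⟩ h
  have hAD : IsAlmostDisjoint (insert (⋃₀ F)ᶜ F) := by
    refine ⟨?_, ?_⟩
    · rintro N (rfl | hN)
      · exact hinf
      · exact hF.prop.1 N hN
    · rintro A (rfl | hA) B (rfl | hB) hAB
      · exact absurd rfl hAB
      · simp [hdisj B hB]
      · rw [Set.inter_comm]
        simp [hdisj A hA]
      · exact hF.prop.2 A hA B hB hAB
  have hmem : (⋃₀ F)ᶜ ∈ F := hF.2 hAD (Set.subset_insert _ _) (Set.mem_insert _ _)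
  have h := hdisj _ hmem
  rw [Set.inter_self] at h
  exact hinf (h ▸ Set.finite_empty)

theorem mainTheorem2 (CH : Cardinal.continuum.{0} = Cardinal.aleph 1) :
    ∃ (F : Set (Set ℕ)) (hF : IsMADFamily F), F.Infinite ∧
      ∀ x : ℕ → StrongDual ℝ (JL₂ F hF.prop),
        (∃ C : ℝ, ∀ n, ‖x n‖ ≤ C) →
        MapClusterPt (0 : WeakDual ℝ (JL₂ F hF.prop)) atTop
          (fun n => StrongDual.toWeakDual (x n)) →
        ∃ φ : ℕ → ℕ, StrictMono φ ∧
          Tendsto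
            (fun k : ℕ => StrongDual.toWeakDual ((1 / (k : ℝ)) • ∑ i ∈ Finset.range k, x (φ i)))
            atTop (𝓝 (0 : WeakDual ℝ (JL₂ F hF.prop))) := by
  obtain ⟨W, _, _, hW, hcount, hbdd⟩ := exists_wellOrder_of_continuum_eq_aleph_one CH
  obtain ⟨N, g, M, hg, hN, hfin, hmax, hsparse, hM, hMs⟩ := exists_sparse_family hW hcount
  have hfin' : ∀ β γ, β ≠ γ → (N β ∩ N γ).Finite := fun β γ h => by
    rcases lt_or_gt_of_ne h with h | h
    · rw [Set.inter_comm]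
      exact hfin γ β h
    · exact hfin β γ h
  let F : Set (Set ℕ) := {A | A.Infinite ∧ ∃ β, N β = A}
  have hAD : IsAlmostDisjoint F := by
    refine ⟨fun A hA => hA.1, ?_⟩
    rintro _ ⟨-, β, rfl⟩ _ ⟨-, γ, rfl⟩ h
    exact hfin' β γ fun h' => h (h' ▸ rfl)
  have hF : IsMADFamily F := by
    refine isMADFamily_of_forall_infinite_inter hAD fun X hX => ?_
    obtain ⟨β, h⟩ := hmax X hX
    exact ⟨N β, ⟨h.mono Set.inter_subset_right, β, rfl⟩, h⟩
  refine ⟨F, hF, hF.infinite_of_isSparse ?_, ?_⟩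
  · rintro _ ⟨-, β, rfl⟩
    exact hsparse β
  rintro x ⟨C, hC⟩ hx
  have hmem : ∀ β, (N β).Infinite → N β ∈ F := fun β h => ⟨h, β, rfl⟩
  let μ : ℕ → ℕ → ℝ := fun n j => x n (jlUnit hF.prop j)
  have hμ : ∀ n, Summable fun j => |μ n j| := fun n => (summable_abs_apply_jlUnit (x n)).1
  -- a bound for the indices at which some `x n` is not given by its measure
  obtain ⟨δ, hδ⟩ : ∃ δ, ∀ β, δ ≤ β → ∀ (h : N β ∈ F) n,
      x n (jlChi hF.prop ⟨N β, h⟩) = setValue (μ n) (N β) := by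
    let G : Set (Set ℕ) := Subtype.val '' ⋃ n, Function.support (jlDefect (x n))
    have hG : G.Countable := (Set.countable_iUnion fun n => countable_support_jlDefect (x n)).image _
    have hGF : G ⊆ F := by
      rintro _ ⟨A, -, rfl⟩
      exact A.2
    have hinj : Set.InjOn N (N ⁻¹' G) := by
      intro β hβ γ hγ h
      by_contra hne
      have := hfin' β γ hne
      rw [← h, Set.inter_self] at this
      exact (hGF hβ).1 this
    obtain ⟨δ, hδ⟩ := hbdd _ (hG.preimage_of_injOn hinj)
    refine ⟨δ, fun β hβ h n => ?_⟩
    by_contra hne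
    refine absurd (hδ β ⟨⟨N β, h⟩, Set.mem_iUnion.2 ⟨n, ?_⟩, rfl⟩) (not_lt.2 hβ)
    exact sub_ne_zero.2 hne
  let T : W → Set (JL₂ F hF.prop) := fun γ =>
    Set.range (jlUnit hF.prop) ∪ ⋃ β ∈ Set.Iic γ, ⋃ h : N β ∈ F, {jlChi hF.prop ⟨N β, h⟩}
  have hTc : ∀ γ, (T γ).Countable := fun γ =>
    (Set.countable_range _).union ((hcount γ).biUnion fun β _ => Set.countable_iUnion fun h =>
      Set.countable_singleton _)
  have hTunit : ∀ γ j, jlUnit hF.prop j ∈ T γ := fun γ j => Or.inl ⟨j, rfl⟩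
  have hTchi : ∀ γ, ∀ β ≤ γ, ∀ h : N β ∈ F, jlChi hF.prop ⟨N β, h⟩ ∈ T γ := fun γ β hβ h =>
    Or.inr (Set.mem_biUnion hβ (Set.mem_iUnion.2 ⟨h, rfl⟩))
  obtain ⟨t, ht⟩ := (hTc δ).exists_eq_range ⟨_, hTunit δ 0⟩
  obtain ⟨i, hi⟩ := hg (μ, δ, fun n j => x n (t j))
  set γ := max i δ with hγ
  have hscale : IsHumpScale (g i) γ N (M i γ) := by
    refine hM i γ ?_
    rw [hi]
    obtain ⟨φ, hφ, hφT⟩ := exists_subseq_tendsto_zero_of_mapClusterPt hx (hTc γ)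
    obtain ⟨ψ, m, hψ, hm, hhump⟩ := exists_gliding_hump (μ := fun k => μ (φ k))
      (fun k => hμ (φ k)) fun j => hφT _ (hTunit γ j)
    refine ⟨m, hm, φ ∘ ψ, hφ.comp hψ, fun j => ?_, fun β hβ hδβ => ?_, hhump⟩
    · have hj : t j ∈ T γ := by
        have h1 : t j ∈ T δ := ht ▸ ⟨j, rfl⟩
        refine Set.union_subset_union_right _ (Set.biUnion_subset_biUnion_left ?_) h1
        exact Set.Iic_subset_Iic.2 (le_max_right _ _)
      exact (hφT _ hj).comp hψ.tendsto_atTop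
    · rcases hN β with h | h
      · have h1 := (hφT _ (hTchi γ β hβ.le (hmem β h))).comp hψ.tendsto_atTop
        refine h1.congr fun k => ?_
        exact hδ β hδβ (hmem β h) _
      · simp [h, setValue_empty]
  obtain ⟨hm, φ, hφ, hφd, hφN, hhump⟩ := hscale
  rw [hi] at hφd hφN hhump
  have havg : ∀ (K : ℕ) (z : JL₂ F hF.prop),
      ((1 / (K : ℝ)) • ∑ k ∈ Finset.range K, x (φ k)) z =
        (K : ℝ)⁻¹ * ∑ k ∈ Finset.range K, x (φ k) z := fun K z => by
    rw [smul_apply, sum_apply, smul_eq_mul, one_div]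
  have hφT : ∀ z ∈ T δ, Tendsto (fun k => x (φ k) z) atTop (𝓝 0) := by
    rw [ht]
    rintro _ ⟨j, rfl⟩
    exact hφd j
  have hC0 : 0 ≤ C := (norm_nonneg _).trans (hC 0)
  refine ⟨φ, hφ, tendsto_toWeakDual_zero_of_dense_span (C := C) (fun K => ?_)
    (dense_span_jlUnit_jlChi hF.prop) ?_⟩
  · rw [norm_smul, Real.norm_eq_abs, abs_of_nonneg (by positivity)]
    have h1 : ‖∑ k ∈ Finset.range K, x (φ k)‖ ≤ K * C := by
      refine (norm_sum_le_of_le _ fun k _ => hC (φ k)).trans_eq ?_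
      simp
    calc 1 / (K : ℝ) * ‖∑ k ∈ Finset.range K, x (φ k)‖ ≤ 1 / (K : ℝ) * (K * C) := by gcongr
      _ = (K : ℝ) / K * C := by ring
      _ ≤ C := mul_le_of_le_one_left hC0 (div_self_le_one _)
  · simp_rw [havg]
    rintro _ (⟨j, rfl⟩ | ⟨⟨A, hA⟩, rfl⟩)
    · exact (hφT _ (hTunit δ j)).cesaro
    · obtain ⟨β, rfl⟩ := hA.2
      rcases le_total β δ with hβ | hβ
      · exact (hφT _ (hTchi δ β hβ hA)).cesaro
      · simp_rw [hδ β hβ hA]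
        rcases lt_or_ge β γ with hβγ | hβγ
        · exact (hφN β hβγ hβ).cesaro
        · refine (hMs β i ((le_max_left _ _).trans hβγ) γ hβγ).tendsto_average hm (C := C) ?_ ?_
          · exact fun k => ((abs_setValue_le_tsum (hμ _) _).trans
              (summable_abs_apply_jlUnit (x (φ k))).2).trans (hC _)
          · exact fun k hk => hhump k _ hk
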